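/- **Conventions.** Let $f$ be a Boolean function family $f=(f_n)_{n\ge 0}$, $f_n:\{0,1\}^n\to\{0,1\}$ (equivalently $f:\{0,1\}^*\to\{0,1\}$). A deterministic Turing machine $M$ has finitely many states, a finite tape alphabet and finitely many two-way infinite tapes (a single tape is allowed). $M$ computes $f$ in time $T:\mathbb{N}\to\mathbb{N}$ if for every $n$ and every $x\in\{0,1\}^n$, $M$ started on the input $x$ (written on the input tape with the head on its first letter, all other cells blank) halts within $T(n)$ steps with the head of its output tape on the bit $f_n(x)$. A circuit on $n$ inputs is a finite directed acyclic graph with $n$ input nodes and finitely many gates (internal nodes), each gate carrying a local Boolean function of the ordered list of nodes wired into it, together with an output node (a gate or an input). Its size is the number of gates, its depth the maximal number of gates on a directed path, its fan-in the maximal number of wires entering a gate. It is a *Boolean circuit* if all gates are AND or OR (of any number of inputs, including none) or NOT, and a *linear threshold circuit* if every gate computes $\mathbf 1\{\sum_i w_i x_i\ge\theta\}$ for some integers $w_i,\theta$. A *DAG representation* of $f_n$ with local arity $k$ is a circuit of fan-in at most $k$, with arbitrary local functions, computing $f_n$. The family $f$ is *compositionally sparse* if there are a constant $k$ and a polynomial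 $p$ such that every $f_n$ has a DAG representation with local arity $k$ and with at most $p(n)$ internal nodes and depth at most $p(n)$. **Theorem.** (a) For every deterministic Turing machine $M$ there is a polynomial $p$ with coefficients in $\mathbb{N}$ such that, whenever $M$ computes a family $f$ in time $T$, for each input length $n$ there exist: 1. a Boolean circuit of size and depth at most $p(T(n))$ computing $f_n$; 2. a linear threshold circuit of size at most $p(T(n))$ computing $f_n$; 3. a Boolean circuit of fan-in at most $2$, and of size and depth at most $p(T(n))$, computing $f_n$; 4. hence a DAG representation of $f_n$ with local arity $2$, at most $p(T(n))$ internal nodes and depth at most $p(T(n))$. (b) Consequently, if $f$ is computed by a deterministic Turing machine in time $q(n)$ for some polynomial $q$ with coefficients in $\mathbb{N}$, then $f$ is compositionally sparse. -/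

import Mathlib

namespace SparseDAG

/-- A family of Boolean functions, one function `{0,1}^n → {0,1}` for each input length `n`
(equivalently, one function `{0,1}^* → {0,1}`). -/
abbrev BoolFamily : Type := (n : ℕ) → (Fin n → Bool) → Bool

/-! ### Deterministic multi-tape Turing machines -/

/-- A deterministic Turing machine with finitely many two-way infinite tapes. The blank symbol is
`default : Γ`. Single-tape machines are the case `numTapes = 1`. -/
structure TuringMachine where
  /-- number of tapes -/
  numTapes : ℕ
  /-- tape that holds the input at the start -/
  inTape : Fin numTapes
  /-- tape from which the output is read (it may be the input tape) -/
  outTape : Fin numTapes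
  /-- tape alphabet -/
  Γ : Type
  [inhabitedΓ : Inhabited Γ]
  [finiteΓ : Finite Γ]
  /-- control states -/
  Q : Type
  [finiteQ : Finite Q]
  /-- start state -/
  start : Q
  /-- the tape symbols that stand for the bits `0` and `1` -/
  bit : Bool → Γ
  bit_injective : Function.Injective bit
  bit_ne_blank : ∀ b, bit b ≠ default
  /-- Transition function. In a given state and with given scanned symbols the machine either halts
  (`none`), or it enters a new state and on each tape writes a symbol and then moves the head by one
  cell (`some dir`) or leaves it where it is (`none`). -/
  δ : Q → (Fin numTapes → Γ) → Option (Q × (Fin numTapes → Γ × Option Turing.Dir))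

namespace TuringMachine

attribute [instance] inhabitedΓ finiteΓ finiteQ

/-- Configurations: the control state, and every tape with its head. -/
structure Cfg (M : TuringMachine) where
  state : M.Q
  tape : Fin M.numTapes → Turing.Tape M.Γ

variable (M : TuringMachine)

/-- The instruction that applies in a configuration. -/
def Cfg.instr {M : TuringMachine} (c : M.Cfg) :
    Option (M.Q × (Fin M.numTapes → M.Γ × Option Turing.Dir)) :=
  M.δ c.state fun i => (c.tape i).head

/-- The machine has halted. -/
def Cfg.Halted {M : TuringMachine} (c : M.Cfg) : Prop := c.instr = none

/-- Write a symbol on the scanned cell, then move the head. -/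
def act {Γ : Type} [Inhabited Γ] (a : Γ × Option Turing.Dir) (t : Turing.Tape Γ) :
    Turing.Tape Γ :=
  match a.2 with
  | none => t.write a.1
  | some d => (t.write a.1).move d

/-- One step of the machine. A halted configuration stays as it is. -/
def step (c : M.Cfg) : M.Cfg :=
  match c.instr with
  | none => c
  | some (q, a) => ⟨q, fun i => act (a i) (c.tape i)⟩

/-- The initial configuration: the input word is on the input tape, with the head on its first
letter; every other cell is blank. -/
def init {n : ℕ} (x : Fin n → Bool) : M.Cfg where
  state := M.start
  tape i := if i = M.inTape then Turing.Tape.mk₁ (List.ofFn fun j => M.bit (x j))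
    else Turing.Tape.mk₁ []

/-- `M` computes `f` in time `T`: on each input `x` of each length `n`, the machine halts within
`T n` steps, with the head of the output tape on the bit `f x`. (As halted configurations do not
change, "within `T n` steps" means that the configuration after `T n` steps is halted.) -/
def ComputesInTime (f : BoolFamily) (T : ℕ → ℕ) : Prop :=
  ∀ (n : ℕ) (x : Fin n → Bool),
    ((M.step)^[T n] (M.init x)).Halted ∧
    (((M.step)^[T n] (M.init x)).tape M.outTape).head = M.bit (f n x)

end TuringMachine

/-- Computable by a deterministic Turing machine in polynomial time. -/
def EfficientlyComputable (f : BoolFamily) : Prop :=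
  ∃ (M : TuringMachine) (q : Polynomial ℕ), M.ComputesInTime f fun n => q.eval n

/-! ### Circuits -/

/-- A directed acyclic graph with `n` input nodes and finitely many internal nodes ("gates"), each
internal node carrying a local Boolean function of the nodes wired into it; one node is the
output. -/
structure Circuit (n : ℕ) where
  /-- gates -/
  Gate : Type
  [fintypeGate : Fintype Gate]
  /-- fan-in (local arity) of a gate -/
  arity : Gate → ℕ
  /-- local function of a gate -/
  op : (g : Gate) → (Fin (arity g) → Bool) → Bool
  /-- the inputs or gates that are wired into a gate -/
  wire : (g : Gate) → Fin (arity g) → Fin n ⊕ Gate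
  /-- No directed cycles: as there are finitely many gates, this is the same as
  well-foundedness of the relation "gate `h` is wired into gate `g`". -/
  acyclic : WellFounded fun h g => ∃ a, wire g a = Sum.inr h
  /-- output node -/
  output : Fin n ⊕ Gate

namespace Circuit

attribute [instance] fintypeGate

variable {n : ℕ} (C : Circuit n)

/-- The bit that gate `g` carries on input `x`. -/
noncomputable def value (x : Fin n → Bool) : C.Gate → Bool :=
  C.acyclic.fix fun g ih => C.op g fun a =>
    match h : C.wire g a with
    | Sum.inl k => x k
    | Sum.inr j => ih j ⟨a, h⟩

/-- The bit that a node (input or gate) carries on input `x`. -/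
noncomputable def nodeValue (x : Fin n → Bool) : Fin n ⊕ C.Gate → Bool :=
  Sum.elim x (C.value x)

theorem value_eq (x : Fin n → Bool) (g : C.Gate) :
    C.value x g = C.op g fun a => C.nodeValue x (C.wire g a) := by
  unfold value
  rw [WellFounded.fix_eq]
  congr 1
  funext a
  split <;> rename_i h <;> exact (congrArg (Sum.elim x (C.value x)) h).symm

/-- The circuit computes `f`. -/
def Computes (f : (Fin n → Bool) → Bool) : Prop :=
  ∀ x, C.nodeValue x C.output = f x

/-- Size: the number of gates. -/
def size : ℕ := Fintype.card C.Gate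

/-- The number of gates on a longest directed path that ends in gate `g`. -/
noncomputable def gateDepth : C.Gate → ℕ :=
  C.acyclic.fix fun g ih => 1 + Finset.univ.sup fun a =>
    match h : C.wire g a with
    | Sum.inl _ => 0
    | Sum.inr j => ih j ⟨a, h⟩

theorem gateDepth_eq (g : C.Gate) :
    C.gateDepth g =
      1 + Finset.univ.sup fun a => Sum.elim (fun _ => 0) C.gateDepth (C.wire g a) := by
  unfold gateDepth
  rw [WellFounded.fix_eq]
  congr 2
  funext a
  split <;> rename_i h <;> exact (congrArg (Sum.elim (fun _ => 0) C.gateDepth) h).symm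

/-- Depth: the number of gates on a longest directed path. -/
noncomputable def depth : ℕ := Finset.univ.sup C.gateDepth

/-- Every gate has fan-in at most `k`. -/
def FanInLE (k : ℕ) : Prop := ∀ g, C.arity g ≤ k

end Circuit

/-- `AND` or `OR` of any number of bits, or `NOT` of one bit. The constants are the `AND` and the
`OR` of no bits. -/
def IsBooleanGate {r : ℕ} (op : (Fin r → Bool) → Bool) : Prop :=
  (∀ x, op x = true ↔ ∀ i, x i = true) ∨
  (∀ x, op x = true ↔ ∃ i, x i = true) ∨
  (r = 1 ∧ ∀ x, op x = true ↔ ∀ i, x i = false)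

/-- A linear threshold gate `𝟙{∑ wᵢ xᵢ ≥ θ}` with integer weights and threshold. -/
def IsThresholdGate {r : ℕ} (op : (Fin r → Bool) → Bool) : Prop :=
  ∃ (w : Fin r → ℤ) (θ : ℤ), ∀ x, op x = true ↔ θ ≤ ∑ i, w i * (if x i then 1 else 0)

/-- Boolean circuits: all gates are `AND`, `OR` and `NOT` gates. -/
def Circuit.IsBoolean {n : ℕ} (C : Circuit n) : Prop := ∀ g, IsBooleanGate (C.op g)

/-- Linear threshold circuits: all gates are linear threshold gates. -/
def Circuit.IsThreshold {n : ℕ} (C : Circuit n) : Prop := ∀ g, IsThresholdGate (C.op g)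

/-- `h` factors over a directed acyclic graph with local arity at most `k`, at most `s` internal
nodes and depth at most `L`. The local functions are arbitrary. -/
def HasDAG {n : ℕ} (h : (Fin n → Bool) → Bool) (k s L : ℕ) : Prop :=
  ∃ D : Circuit n, D.FanInLE k ∧ D.Computes h ∧ D.size ≤ s ∧ D.depth ≤ L

/-- A family is compositionally sparse if its members factor over directed acyclic graphs with
local arity `O(1)` whose numbers of internal nodes and depths are polynomial in `n`. -/
def CompositionallySparse (h : BoolFamily) : Prop :=
  ∃ (k : ℕ) (p : Polynomial ℕ), ∀ n, HasDAG (h n) k (p.eval n) (p.eval n)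

end SparseDAG

/-! Computation is local. If tape cells are addressed relative to the heads, a move shifts the tape,
so the next symbol at position `z` is determined by the state, the scanned symbols and the old
symbols at `z - 1`, `z`, `z + 1`. In the one-hot encoding each bit of the next configuration is thus
a function of a number of old bits that depends only on `M`, and Shannon expansion realises it with
constantly many fan-in 2 gates (`exists_localFunctions`, `exists_local`).

To read the output after `T` steps only the head cell matters, and each step backwards widens the
window by one. So radius `T - t` suffices at time `t`, and `T` layers of `O(T)` bits give size `O(T
^ 2)` and depth `O(T)` (`exists_jointlyComputable_cfgBit`). This one circuit serves for all four
items, because AND, OR and NOT are threshold gates; (b) follows by composing polynomials. -/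

namespace SparseDAG

/-! ### Adding layers to a circuit and changing its output -/

namespace Circuit

variable {n : ℕ}

theorem gateDepth_le_depth (C : Circuit n) (g : C.Gate) : C.gateDepth g ≤ C.depth :=
  Finset.le_sup (f := C.gateDepth) (Finset.mem_univ g)

theorem gateDepth_lt_of_wire (C : Circuit n) {g h : C.Gate} {a : Fin (C.arity g)}
    (e : C.wire g a = Sum.inr h) : C.gateDepth h < C.gateDepth g := by
  rw [C.gateDepth_eq g, Nat.lt_one_add_iff]
  have := Finset.le_sup (f := fun a => Sum.elim (fun _ => 0) C.gateDepth (C.wire g a))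
    (Finset.mem_univ a)
  simpa [e] using this

/-- Add a layer of gates, all of them wired into nodes of the given circuit. -/
noncomputable def extend (C : Circuit n) (J : Type) [Fintype J] (ar : J → ℕ)
    (op : (j : J) → (Fin (ar j) → Bool) → Bool)
    (wire : (j : J) → Fin (ar j) → Fin n ⊕ C.Gate) : Circuit n where
  Gate := C.Gate ⊕ J
  arity := Sum.elim C.arity ar
  op := fun g => match g with
    | Sum.inl g => C.op g
    | Sum.inr j => op j
  wire := fun g => match g with
    | Sum.inl g => fun a => (C.wire g a).map id Sum.inl
    | Sum.inr j => fun a => (wire j a).map id Sum.inl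
  acyclic := by
    -- Rank old gates by their depth and put all new gates above them; every wire increases the
    -- rank.
    refine Subrelation.wf ?_
      (measure (Sum.elim C.gateDepth fun _ : J => C.depth + 1)).wf
    rintro h (g | j) ⟨a, ha⟩
    · rcases e : C.wire g a with k | g'
      · simp [e] at ha
      · simp only [e, Sum.map_inr, Sum.inr.injEq] at ha
        subst ha
        exact C.gateDepth_lt_of_wire e
    · rcases e : wire j a with k | g'
      · simp [e] at ha
      · simp only [e, Sum.map_inr, Sum.inr.injEq] at ha
        subst ha
        exact Nat.lt_succ_of_le (C.gateDepth_le_depth g')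
  output := C.output.map id Sum.inl

/-- Choose another output node. -/
def withOutput (C : Circuit n) (v : Fin n ⊕ C.Gate) : Circuit n :=
  { C with output := v }

theorem withOutput_value (C : Circuit n) (v : Fin n ⊕ C.Gate) (x : Fin n → Bool) (g : C.Gate) :
    (C.withOutput v).value x g = C.value x g := by
  induction g using C.acyclic.induction with
  | _ g ih =>
    refine ((C.withOutput v).value_eq x g).trans (Eq.trans ?_ (C.value_eq x g).symm)
    change C.op g _ = C.op g _
    congr 1
    funext a
    change (C.withOutput v).nodeValue x (C.wire g a) = _
    rcases e : C.wire g a with k | h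
    · rfl
    · exact ih h ⟨a, e⟩

theorem withOutput_nodeValue (C : Circuit n) (v : Fin n ⊕ C.Gate) (x : Fin n → Bool)
    (u : Fin n ⊕ C.Gate) : (C.withOutput v).nodeValue x u = C.nodeValue x u :=
  congrArg (fun y => Sum.elim x y u) (funext (C.withOutput_value v x))

theorem withOutput_depth (C : Circuit n) (v : Fin n ⊕ C.Gate) :
    (C.withOutput v).depth = C.depth := by
  refine congrArg (Finset.sup Finset.univ) (funext fun g => ?_)
  induction g using C.acyclic.induction with
  | _ g ih =>
    refine ((C.withOutput v).gateDepth_eq g).trans (Eq.trans ?_ (C.gateDepth_eq g).symm)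
    change 1 + (Finset.univ : Finset (Fin (C.arity g))).sup _ = _
    congr 2
    funext a
    change Sum.elim _ _ (C.wire g a) = _
    rcases e : C.wire g a with k | h
    · rfl
    · exact ih h ⟨a, e⟩

section Extend

variable (C : Circuit n) (J : Type) [Fintype J] (ar : J → ℕ)
  (op : (j : J) → (Fin (ar j) → Bool) → Bool)
  (wire : (j : J) → Fin (ar j) → Fin n ⊕ C.Gate)

theorem extend_value_inl (x : Fin n → Bool) (g : C.Gate) :
    (C.extend J ar op wire).value x (Sum.inl g) = C.value x g := by
  induction g using C.acyclic.induction with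
  | _ g ih =>
    refine ((C.extend J ar op wire).value_eq x (Sum.inl g)).trans
      (Eq.trans ?_ (C.value_eq x g).symm)
    change C.op g _ = C.op g _
    congr 1
    funext a
    change (C.extend J ar op wire).nodeValue x ((C.wire g a).map id Sum.inl) = _
    rcases e : C.wire g a with k | h
    · rfl
    · exact ih h ⟨a, e⟩

theorem extend_nodeValue_map (x : Fin n → Bool) (v : Fin n ⊕ C.Gate) :
    (C.extend J ar op wire).nodeValue x (v.map id Sum.inl) = C.nodeValue x v := by
  rcases v with k | g
  · rfl
  · exact C.extend_value_inl J ar op wire x g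

theorem extend_nodeValue_inr (x : Fin n → Bool) (j : J) :
    (C.extend J ar op wire).nodeValue x (Sum.inr (Sum.inr j)) =
      op j fun a => C.nodeValue x (wire j a) := by
  refine ((C.extend J ar op wire).value_eq x (Sum.inr j)).trans ?_
  change op j _ = op j _
  congr 1
  funext a
  exact C.extend_nodeValue_map J ar op wire x (wire j a)

theorem extend_gateDepth_inl (g : C.Gate) :
    (C.extend J ar op wire).gateDepth (Sum.inl g) = C.gateDepth g := by
  induction g using C.acyclic.induction with
  | _ g ih =>
    refine ((C.extend J ar op wire).gateDepth_eq (Sum.inl g)).trans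
      (Eq.trans ?_ (C.gateDepth_eq g).symm)
    change 1 + (Finset.univ : Finset (Fin (C.arity g))).sup _ = _
    congr 2
    funext a
    change Sum.elim _ _ ((C.wire g a).map id Sum.inl) = _
    rcases e : C.wire g a with k | h
    · rfl
    · exact ih h ⟨a, e⟩

theorem extend_gateDepth_inr (j : J) :
    (C.extend J ar op wire).gateDepth (Sum.inr j) ≤ C.depth + 1 := by
  refine ((C.extend J ar op wire).gateDepth_eq (Sum.inr j)).trans_le ?_
  rw [add_comm]
  refine Nat.add_le_add_right (Finset.sup_le fun a _ => ?_) 1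
  change Sum.elim _ _ ((wire j a).map id Sum.inl) ≤ _
  rcases wire j a with k | h
  · exact Nat.zero_le _
  · exact (C.extend_gateDepth_inl J ar op wire h).trans_le (C.gateDepth_le_depth h)

theorem extend_depth_le : (C.extend J ar op wire).depth ≤ C.depth + 1 := by
  refine Finset.sup_le ?_
  rintro (g | j) -
  · rw [extend_gateDepth_inl]
    exact (C.gateDepth_le_depth g).trans (Nat.le_succ _)
  · exact C.extend_gateDepth_inr J ar op wire j

theorem extend_size : (C.extend J ar op wire).size = C.size + Fintype.card J :=
  Fintype.card_sum

end Extend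

end Circuit

/-- A single Boolean circuit of fan-in at most `2`, with size at most `s` and depth at most `d`,
has for each function of the family `F` a node that computes it. -/
def JointlyComputable {n : ℕ} (s d : ℕ) {ι : Type} (F : ι → (Fin n → Bool) → Bool) : Prop :=
  ∃ C : Circuit n, C.IsBoolean ∧ C.FanInLE 2 ∧ C.size ≤ s ∧ C.depth ≤ d ∧
    ∃ node : ι → Fin n ⊕ C.Gate, ∀ i x, C.nodeValue x (node i) = F i x

theorem isBooleanGate_const (op : (Fin 0 → Bool) → Bool) : IsBooleanGate op := by
  rcases h : op Fin.elim0 with _ | _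
  · right; left
    intro x
    simp [Subsingleton.elim x Fin.elim0, h]
  · left
    intro x
    simp [Subsingleton.elim x Fin.elim0, h]

theorem isBooleanGate_not : IsBooleanGate fun x : Fin 1 → Bool => !x 0 := by
  right; right
  exact ⟨rfl, fun x => by simp⟩

theorem isBooleanGate_and : IsBooleanGate fun x : Fin 2 → Bool => x 0 && x 1 := by
  left
  intro x
  simp [Fin.forall_fin_two]

theorem isBooleanGate_or : IsBooleanGate fun x : Fin 2 → Bool => x 0 || x 1 := by
  right; left
  intro x
  simp [Fin.exists_fin_two]

/-! ### Families of bits computed by one circuit -/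

namespace JointlyComputable

variable {n s d : ℕ} {ι : Type} {F : ι → (Fin n → Bool) → Bool}

theorem mono (h : JointlyComputable s d F) {s' d' : ℕ} (hs : s ≤ s') (hd : d ≤ d') :
    JointlyComputable s' d' F := by
  obtain ⟨C, hB, hk, hsz, hdp, h⟩ := h
  exact ⟨C, hB, hk, hsz.trans hs, hdp.trans hd, h⟩

theorem reindex (h : JointlyComputable s d F) {κ : Type} (G : κ → (Fin n → Bool) → Bool)
    (e : κ → ι) (hG : ∀ k x, G k x = F (e k) x) : JointlyComputable s d G := by
  obtain ⟨C, hB, hk, hsz, hdp, node, h⟩ := h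
  exact ⟨C, hB, hk, hsz, hdp, node ∘ e, fun k x => (h (e k) x).trans (hG k x).symm⟩

/-- The inputs are computed by a circuit with one gate. -/
theorem inputs (n : ℕ) :
    JointlyComputable 1 1 (Sum.elim (fun k x => x k) fun _ _ => true :
      Fin n ⊕ Unit → (Fin n → Bool) → Bool) := by
  -- The constant gate is a node to point to for bits that depend on no input; for `n = 0` there is
  -- no input node.
  let C : Circuit n :=
    { Gate := Unit
      arity := fun _ => 0
      op := fun _ _ => true
      wire := fun _ => Fin.elim0
      acyclic := ⟨fun a => ⟨a, fun _ ⟨i, _⟩ => i.elim0⟩⟩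
      output := Sum.inr () }
  refine ⟨C, fun _ => isBooleanGate_const _, fun _ => Nat.zero_le _, le_rfl, ?_, id, ?_⟩
  · refine Finset.sup_le fun g _ => ?_
    rw [Circuit.gateDepth_eq]
    refine Nat.add_le_add_left (m := 0) (Finset.sup_le fun a _ => ?_) 1
    exact Fin.elim0 a
  · rintro (k | u) x
    · rfl
    · change C.value x u = true
      rw [Circuit.value_eq]

theorem layer (h : JointlyComputable s d F) {J : Type} [Fintype J] (ar : J → ℕ)
    (op : (j : J) → (Fin (ar j) → Bool) → Bool) (har : ∀ j, ar j ≤ 2)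
    (hop : ∀ j, IsBooleanGate (op j)) (w : (j : J) → Fin (ar j) → ι) :
    JointlyComputable (s + Fintype.card J) (d + 1)
      (Sum.elim F fun j x => op j fun a => F (w j a) x) := by
  obtain ⟨C, hB, hk, hsz, hdp, node, hn⟩ := h
  refine ⟨C.extend J ar op fun j a => node (w j a), ?_, ?_, ?_, ?_,
    Sum.elim (fun i => (node i).map id Sum.inl) (fun j => Sum.inr (Sum.inr j)), ?_⟩
  · rintro (g | j)
    · exact hB g
    · exact hop j
  · rintro (g | j)
    · exact hk g
    · exact har j
  · rw [Circuit.extend_size]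
    exact Nat.add_le_add_right hsz _
  · exact (C.extend_depth_le J ar op _).trans (Nat.add_le_add_right hdp 1)
  · rintro (i | j) x
    · exact (C.extend_nodeValue_map J ar op _ x (node i)).trans (hn i x)
    · refine (C.extend_nodeValue_inr J ar op _ x j).trans ?_
      simp only [hn, Sum.elim_inr]

/-- Shannon expansion: functions of `K` already computed bits cost a constant number of gates
each. -/
theorem exists_localFunctions (K : ℕ) : ∃ c e : ℕ, ∀ {n s d : ℕ} {ι : Type}
    {F : ι → (Fin n → Bool) → Bool}, JointlyComputable s d F →
    ∀ {J : Type} [Fintype J] (φ : J → (Fin K → Bool) → Bool) (w : J → Fin K → ι),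
    JointlyComputable (s + c * Fintype.card J) (d + e)
      (Sum.elim F fun j x => φ j fun a => F (w j a) x) := by
  induction K with
  | zero =>
    refine ⟨1, 1, fun h J _ φ w => ?_⟩
    rw [one_mul]
    exact h.layer (fun _ => 0) φ (fun _ => Nat.zero_le _) (fun j => isBooleanGate_const _) w
  | succ K ih =>
    obtain ⟨c, e, ih⟩ := ih
    -- Per function: two cofactors (`2 * c`), one NOT, two ANDs and one OR; the last three kinds
    -- form three further layers.
    refine ⟨2 * c + 4, e + 3, fun {n s d ι F} h J _ φ w => ?_⟩
    have h₁ := ih h (J := J × Bool) (fun j y => φ j.1 (Fin.cons j.2 y)) fun j a => w j.1 a.succ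
    have h₂ := h₁.layer (J := J) (fun _ => 1) (fun _ y => !y 0) (fun _ => by norm_num)
      (fun _ => isBooleanGate_not) fun j _ => Sum.inl (w j 0)
    have h₃ := h₂.layer (J := J × Bool) (fun _ => 2) (fun _ y => y 0 && y 1) (fun _ => le_rfl)
      (fun _ => isBooleanGate_and)
      fun j => ![bif j.2 then Sum.inl (Sum.inl (w j.1 0)) else Sum.inr j.1, Sum.inl (Sum.inr j)]
    have h₄ := h₃.layer (J := J) (fun _ => 2) (fun _ y => y 0 || y 1) (fun _ => le_rfl)
      (fun _ => isBooleanGate_or) fun j => ![Sum.inr (j, true), Sum.inr (j, false)]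
    refine (h₄.mono ?_ le_rfl).reindex _
      (Sum.elim (fun i => Sum.inl (Sum.inl (Sum.inl (Sum.inl i)))) Sum.inr) ?_
    · simp only [Fintype.card_prod, Fintype.card_bool]
      apply le_of_eq
      ring
    · rintro (i | j) x
      · rfl
      · have hc : (fun a => F (w j a) x) =
            Fin.cons (F (w j 0) x) fun a : Fin K => F (w j a.succ) x := by
          funext a
          refine Fin.cases rfl (fun _ => rfl) a
        simp only [Sum.elim_inr, hc]
        cases hb : F (w j 0) x <;> simp [hb]

/-- Functions that depend only on a bounded number of already computed bits cost a constant number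
of gates each. -/
theorem exists_local (V : Type) [Finite V] : ∃ c e : ℕ, ∀ {n s d : ℕ} {ι : Type}
    {F : ι → (Fin n → Bool) → Bool}, JointlyComputable s d F →
    ∀ {J : Type} [Fintype J] (G : J → (Fin n → Bool) → Bool) (w : J → V → ι),
    (∀ j x y, (∀ v, F (w j v) x = F (w j v) y) → G j x = G j y) →
    JointlyComputable (s + c * Fintype.card J) (d + e) G := by
  obtain ⟨K, ⟨σ⟩⟩ := Finite.exists_equiv_fin V
  obtain ⟨c, e, H⟩ := exists_localFunctions K
  refine ⟨c, e, fun {n s d ι F} h J _ G w hG => ?_⟩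
  have hφ : ∀ j, ∃ φ : (Fin K → Bool) → Bool, ∀ x, G j x = φ fun a => F (w j (σ.symm a)) x := by
    intro j
    have hf : (G j).FactorsThrough fun x (a : Fin K) => F (w j (σ.symm a)) x := by
      intro x y hxy
      refine hG j x y fun v => ?_
      simpa using congrFun hxy (σ v)
    -- The value `false` is used only at bit patterns that no input produces.
    exact ⟨Function.extend (fun x (a : Fin K) => F (w j (σ.symm a)) x) (G j) fun _ => false,
      fun x => (hf.extend_apply _ x).symm⟩
  choose φ hφ using hφ
  exact (H h φ fun j a => w j (σ.symm a)).reindex G Sum.inr hφ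

end JointlyComputable

/-! ### Configurations as families of bits -/

namespace TuringMachine

variable (M : TuringMachine)

/-- Writing affects only cell `0`, and moving shifts the head-relative coordinates by one. -/
theorem act_nth_congr {Γ : Type} [Inhabited Γ] (a : Γ × Option Turing.Dir) {t u : Turing.Tape Γ}
    {z : ℤ} (h : ∀ σ : SignType, t.nth (z + σ) = u.nth (z + σ)) :
    (act a t).nth z = (act a u).nth z := by
  have h0 := h 0
  have h1 := h 1
  have h2 := h (-1)
  simp only [SignType.coe_zero, SignType.coe_one, SignType.coe_neg_one, add_zero,
    ← sub_eq_add_neg] at h0 h1 h2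
  rcases a with ⟨b, _ | _ | _⟩ <;>
    simp [act, Turing.Tape.write_nth, Turing.Tape.move_left_nth, Turing.Tape.move_right_nth,
      h0, h1, h2]

theorem step_state_congr {c c' : M.Cfg} (hq : c.state = c'.state)
    (hh : ∀ i, (c.tape i).head = (c'.tape i).head) :
    (M.step c).state = (M.step c').state := by
  have hi : c.instr = c'.instr := by simp only [Cfg.instr, hq, hh]
  unfold step
  rw [hi]
  rcases c'.instr with _ | ⟨q, a⟩
  · exact hq
  · rfl

theorem step_nth_congr {c c' : M.Cfg} (hq : c.state = c'.state)
    (hh : ∀ i, (c.tape i).head = (c'.tape i).head) {i : Fin M.numTapes} {z : ℤ}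
    (hz : ∀ σ : SignType, (c.tape i).nth (z + σ) = (c'.tape i).nth (z + σ)) :
    ((M.step c).tape i).nth z = ((M.step c').tape i).nth z := by
  have hi : c.instr = c'.instr := by simp only [Cfg.instr, hq, hh]
  unfold step
  rw [hi]
  rcases c'.instr with _ | ⟨q, a⟩
  · simpa using hz 0
  · exact act_nth_congr (a i) hz

/-- Positions, relative to the head, at distance at most `r`. -/
abbrev Window (r : ℕ) : Type := {z : ℤ // z ∈ Finset.Icc (-(r : ℤ)) r}

/-- Names of the bits that describe a configuration up to distance `r` from the heads. -/
abbrev BitIndex (r : ℕ) : Type := M.Q ⊕ Fin M.numTapes × Window r × M.Γ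

open Classical in
/-- The bits that describe a configuration in the one-hot encoding. -/
noncomputable def cfgBit {r : ℕ} (c : M.Cfg) : M.BitIndex r → Bool :=
  Sum.elim (fun q => decide (c.state = q)) fun p => decide ((c.tape p.1).nth p.2.1 = p.2.2)

theorem cfgBit_inl {r : ℕ} {c : M.Cfg} {q : M.Q} :
    M.cfgBit c (Sum.inl q : M.BitIndex r) = true ↔ c.state = q := by
  simp [cfgBit]

theorem cfgBit_inr {r : ℕ} {c : M.Cfg} {i : Fin M.numTapes} {z : Window r} {a : M.Γ} :
    M.cfgBit c (Sum.inr (i, z, a)) = true ↔ (c.tape i).nth z.1 = a := by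
  simp [cfgBit]

/-- Names of the bits on which a bit of the next configuration depends: the state, the scanned
symbols, and the symbols around one position. -/
abbrev LocalIndex : Type := M.Q ⊕ Fin M.numTapes × Option SignType × M.Γ

variable {M}

theorem window_add_sign {r : ℕ} {z : ℤ} (hz : z ∈ Finset.Icc (-(r : ℤ)) r) (σ : SignType) :
    z + σ ∈ Finset.Icc (-((r + 1 : ℕ) : ℤ)) (r + 1 : ℕ) := by
  rw [Finset.mem_Icc] at hz ⊢
  push_cast
  rcases σ with _ | _ | _ <;> simp <;> omega

/-- The centre of the window. -/
def Window.zero (r : ℕ) : Window r := ⟨0, by simp⟩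

/-- The position from which a bit of the next configuration is computed. -/
def BitIndex.position {r : ℕ} : M.BitIndex r → Window r :=
  -- State bits need no neighbouring cells, so their position is a dummy.
  Sum.elim (fun _ => Window.zero r) fun p => p.2.1

/-- The bits of a configuration from which a bit of the next configuration is computed. -/
def BitIndex.source {r : ℕ} (j : M.BitIndex r) : M.LocalIndex → M.BitIndex (r + 1) :=
  Sum.map id fun p =>
    (p.1, p.2.1.elim (Window.zero (r + 1))
      (fun σ => ⟨j.position.1 + σ, window_add_sign j.position.2 σ⟩), p.2.2)

/-- One-hot bits determine what they encode: the bit naming the state or symbol of `c'` is true for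
`c'`, hence for `c`. Dependence is all that is needed, so the transition is never written as a
formula. -/
theorem cfgBit_step_congr {r : ℕ} (j : M.BitIndex r) {c c' : M.Cfg}
    (h : ∀ v, M.cfgBit c (j.source v) = M.cfgBit c' (j.source v)) :
    M.cfgBit (M.step c) j = M.cfgBit (M.step c') j := by
  have hq : c.state = c'.state :=
    M.cfgBit_inl.1 ((h (Sum.inl c'.state)).trans (M.cfgBit_inl.2 rfl))
  have hh : ∀ i, (c.tape i).head = (c'.tape i).head := fun i =>
    M.cfgBit_inr.1 ((h (Sum.inr (i, none, (c'.tape i).head))).trans (M.cfgBit_inr.2 rfl))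
  have hz : ∀ i (σ : SignType), (c.tape i).nth (j.position.1 + σ) =
      (c'.tape i).nth (j.position.1 + σ) := fun i σ =>
    M.cfgBit_inr.1 ((h (Sum.inr (i, some σ, (c'.tape i).nth (j.position.1 + σ)))).trans
      (M.cfgBit_inr.2 rfl))
  rw [Bool.eq_iff_iff]
  rcases j with q | ⟨i, z, a⟩
  · rw [cfgBit_inl, cfgBit_inl, M.step_state_congr hq hh]
  · rw [cfgBit_inr, cfgBit_inr, M.step_nth_congr hq hh (z := z.1) (hz i)]

open Classical in
/-- The input on which a bit of the initial configuration depends, if there is one. -/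
noncomputable def BitIndex.input (n : ℕ) {r : ℕ} : M.BitIndex r → Fin n ⊕ Unit :=
  Sum.elim (fun _ => Sum.inr ()) fun p =>
    -- Negative positions are sent to letter `0` by `toNat`. This is harmless: those cells are
    -- blank, and a superfluous dependence is allowed.
    if h : p.2.1.1.toNat < n then Sum.inl ⟨p.2.1.1.toNat, h⟩ else Sum.inr ()

theorem init_nth_congr {n : ℕ} {x y : Fin n → Bool} (i : Fin M.numTapes) (z : ℤ)
    (h : ∀ hz : z.toNat < n, x ⟨z.toNat, hz⟩ = y ⟨z.toNat, hz⟩) :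
    ((M.init x).tape i).nth z = ((M.init y).tape i).nth z := by
  unfold init
  by_cases hi : i = M.inTape
  · simp only [hi, if_true]
    rcases z with m | m
    · simp only [Turing.Tape.mk₁, Turing.Tape.mk₂, Int.ofNat_eq_natCast, Turing.Tape.mk'_nth_nat,
        Turing.ListBlank.nth_mk, List.getI_eq_getElem?_getD, List.getElem?_ofFn]
      by_cases hm : m < n
      · have := h hm
        simp only [Int.ofNat_eq_natCast, Int.toNat_natCast] at this
        simp [hm, this]
      · simp [hm]
    · rfl
  · simp only [hi, if_false]

theorem cfgBit_init_congr {n r : ℕ} {x y : Fin n → Bool} (j : M.BitIndex r)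
    (h : Sum.elim (fun k x => x k) (fun _ _ => true) (BitIndex.input n j) x =
      Sum.elim (fun k x => x k) (fun _ _ => true) (BitIndex.input n j) y) :
    M.cfgBit (M.init x) j = M.cfgBit (M.init y) j := by
  rcases j with q | ⟨i, z, a⟩
  · rfl
  · simp only [cfgBit, Sum.elim_inr]
    rw [init_nth_congr i z.1]
    intro hz
    simpa [BitIndex.input, hz] using h

variable (M)

noncomputable instance : Fintype M.Q := Fintype.ofFinite _

noncomputable instance : Fintype M.Γ := Fintype.ofFinite _

/-- The number of bits that describe a configuration up to distance `r`. -/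
theorem card_bitIndex (r : ℕ) : Fintype.card (M.BitIndex r) =
    Fintype.card M.Q + M.numTapes * ((2 * r + 1) * Fintype.card M.Γ) := by
  have : (r + 1 + r : ℤ).toNat = 2 * r + 1 := by omega
  simp [this]

/-- Induction on `t`: the bits of radius `r` at time `t + 1` are local in those of radius `r + 1` at
time `t`, and `t + r = T` is preserved. Every layer is charged for the largest window, of radius
`T`. -/
theorem exists_jointlyComputable_cfgBit : ∃ c₀ e₀ c e : ℕ, ∀ n T t r : ℕ, t + r = T →
    JointlyComputable (1 + (c₀ + t * c) * Fintype.card (M.BitIndex T)) (1 + e₀ + t * e)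
      fun (j : M.BitIndex r) (x : Fin n → Bool) => M.cfgBit ((M.step)^[t] (M.init x)) j := by
  obtain ⟨c₀, e₀, H₀⟩ := JointlyComputable.exists_local Unit
  obtain ⟨c, e, H⟩ := JointlyComputable.exists_local M.LocalIndex
  refine ⟨c₀, e₀, c, e, fun n T t => ?_⟩
  induction t with
  | zero =>
    rintro r rfl
    refine (H₀ (JointlyComputable.inputs n) _ (fun j _ => BitIndex.input n j) ?_).mono
      (by simp) (by simp)
    exact fun j x y h => cfgBit_init_congr j (h ())
  | succ t ih =>
    intro r hr
    refine (H (ih (r + 1) (by omega)) _ (fun j => BitIndex.source j) ?_).mono ?_ ?_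
    · intro j x y h
      simp only [Function.iterate_succ_apply']
      exact cfgBit_step_congr j h
    · have : Fintype.card (M.BitIndex r) ≤ Fintype.card (M.BitIndex T) := by
        rw [card_bitIndex, card_bitIndex]
        gcongr
        omega
      nlinarith
    · apply le_of_eq
      ring

theorem exists_booleanCircuit : ∃ p : Polynomial ℕ,
    ∀ (f : BoolFamily) (T : ℕ → ℕ), M.ComputesInTime f T → ∀ n : ℕ,
      ∃ C : Circuit n, C.IsBoolean ∧ C.FanInLE 2 ∧ C.Computes (f n) ∧
        C.size ≤ p.eval (T n) ∧ C.depth ≤ p.eval (T n) := by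
  obtain ⟨c₀, e₀, c, e, H⟩ := M.exists_jointlyComputable_cfgBit
  let A : Polynomial ℕ := 1 + (.C c₀ + .X * .C c) *
    (.C (Fintype.card M.Q) + .C M.numTapes * ((2 * .X + 1) * .C (Fintype.card M.Γ)))
  let B : Polynomial ℕ := 1 + .C e₀ + .X * .C e
  refine ⟨A + B, fun f T hM n => ?_⟩
  obtain ⟨C, hB, hk, hs, hd, node, hn⟩ := H n (T n) (T n) 0 (by simp)
  -- At time `T n` the window has radius `0`. The bit "the output head scans `M.bit true`" is the
  -- answer, by injectivity of `M.bit`.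
  refine ⟨C.withOutput (node (Sum.inr (M.outTape, Window.zero 0, M.bit true))),
    hB, hk, ?_, le_trans hs ?_, (C.withOutput_depth _).trans_le (hd.trans ?_)⟩
  · intro x
    refine (C.withOutput_nodeValue _ x _).trans ((hn _ x).trans ?_)
    simp only [cfgBit, Sum.elim_inr, Window.zero, Turing.Tape.nth_zero, (hM n x).2,
      M.bit_injective.eq_iff]
    cases f n x <;> simp
  · rw [card_bitIndex, Polynomial.eval_add]
    simp [A]
  · rw [Polynomial.eval_add]
    simp [B]

end TuringMachine

/-- AND is `∑ xᵢ ≥ r`, OR is `∑ xᵢ ≥ 1`, and NOT is `-x ≥ 0`. -/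
theorem IsBooleanGate.isThresholdGate {r : ℕ} {op : (Fin r → Bool) → Bool}
    (h : IsBooleanGate op) : IsThresholdGate op := by
  rcases h with h | h | ⟨rfl, h⟩
  · refine ⟨fun _ => 1, r, fun x => (h x).trans ?_⟩
    constructor
    · intro hx
      simp [hx]
    · intro hx
      by_contra! hne
      obtain ⟨i, hi⟩ := hne
      refine hx.not_gt ?_
      calc ∑ i, (1 : ℤ) * (if x i then 1 else 0) < ∑ _i : Fin r, (1 : ℤ) := by
            refine Finset.sum_lt_sum (fun j _ => ?_) ⟨i, Finset.mem_univ i, by simp [hi]⟩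
            split <;> simp
        _ = r := by simp
  · refine ⟨fun _ => 1, 1, fun x => (h x).trans ?_⟩
    constructor
    · rintro ⟨i, hi⟩
      have := Finset.single_le_sum (f := fun i => (1 : ℤ) * (if x i then 1 else 0))
        (fun j _ => by split <;> simp) (Finset.mem_univ i)
      simpa [hi] using this
    · intro hx
      by_contra! hne
      simp [hne] at hx
  · refine ⟨fun _ => -1, 0, fun x => (h x).trans ?_⟩
    cases hx : x 0 <;> simp [hx]

end SparseDAG

theorem mainTheorem3 :
    (∀ M : SparseDAG.TuringMachine, ∃ p : Polynomial ℕ,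
      ∀ (f : SparseDAG.BoolFamily) (T : ℕ → ℕ), M.ComputesInTime f T → ∀ n : ℕ,
        (∃ C : SparseDAG.Circuit n, C.IsBoolean ∧ C.Computes (f n) ∧
          C.size ≤ p.eval (T n) ∧ C.depth ≤ p.eval (T n)) ∧
        (∃ C : SparseDAG.Circuit n, C.IsThreshold ∧ C.Computes (f n) ∧
          C.size ≤ p.eval (T n)) ∧
        (∃ C : SparseDAG.Circuit n, C.IsBoolean ∧ C.FanInLE 2 ∧ C.Computes (f n) ∧
          C.size ≤ p.eval (T n) ∧ C.depth ≤ p.eval (T n)) ∧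
        SparseDAG.HasDAG (f n) 2 (p.eval (T n)) (p.eval (T n))) ∧
    (∀ f : SparseDAG.BoolFamily,
      SparseDAG.EfficientlyComputable f → SparseDAG.CompositionallySparse f) := by
  constructor
  · intro M
    obtain ⟨p, hp⟩ := M.exists_booleanCircuit
    refine ⟨p, fun f T hM n => ?_⟩
    obtain ⟨C, hB, hk, hC, hs, hd⟩ := hp f T hM n
    exact ⟨⟨C, hB, hC, hs, hd⟩, ⟨C, fun g => (hB g).isThresholdGate, hC, hs⟩,
      ⟨C, hB, hk, hC, hs, hd⟩, ⟨C, hk, hC, hs, hd⟩⟩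
  · rintro f ⟨M, q, hM⟩
    obtain ⟨p, hp⟩ := M.exists_booleanCircuit
    refine ⟨2, p.comp q, fun n => ?_⟩
    obtain ⟨C, -, hk, hC, hs, hd⟩ := hp f _ hM n
    rw [Polynomial.eval_comp]
    exact ⟨C, hk, hC, hs, hd⟩
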